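/- Let $D\ge 1$, $d,J\ge 0$ be integers and let $p,g^{(1)},\dots,g^{(J)}$ be real polynomials in $D$ variables of total degree at most $d$. Consider the original problem of minimizing $p(x)$ over $$\mathcal S=\{x\in[-1,1]^D:\ g^{(j)}(x)=0,\ j=1,\dots,J\}.$$ For $\mu=\{\mu^{(l)}_{i}\}\in\mathbb R^{(2d+1)\times D\times 2}$, with entries $\mu^{(l)}_{i,n}$ ($l=1,2$; $i=1,\dots,D$; $0\le n\le 2d$), put $\phi_n(\mu^{(l)})=\prod_{i=1}^D\mu^{(l)}_{i,n_i}$ and $\phi_n(\mu)=\phi_n(\mu^{(1)})+\phi_n(\mu^{(2)})$ for multi-indices $n$. For a vector $s=(s_0,\dots,s_{2d})$ and a univariate polynomial $h=\sum_k h_kx^k$ let $\mathcal M_e(s;h)$ be the $(e+1)\times(e+1)$ matrix with entries $\sum_k h_k s_{k+m+n}$, $0\le m,n\le e$ (the empty matrix if $e=-1$), and write $\mathcal M_e(s)=\mathcal M_e(s;1)$. The reformulation (with $L=2$) is the problem of minimizing $\sum_{n}p_n\phi_n(\mu)$ over the set of all $\mu\in\mathbb R^{(2d+1)\times D\times 2}$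 such that, for all $i,l,j$, $$\mathcal M_d(\mu_i^{(l)})\succeq0,\qquad \mathcal M_{d-1}(\mu_i^{(l)};1-x^2)\succeq0,\qquad \sum_n\gamma^{(j)}_n\phi_n(\mu^{(l)})=0,\qquad \phi_{(0,\dots,0)}(\mu)=1,$$ where $\gamma^{(j)}$ is the coefficient vector of $(g^{(j)})^2$. Local minima of the reformulation are taken relative to this feasible set, in the usual topology of $\mathbb R^{(2d+1)\times D\times2}$. Finite Borel measures $\mu^{(l)}_i(\cdot)$ on $\mathbb R$ supported on $[-1,1]$ represent $\mu$ if $\int x^n\,\mathrm d\mu^{(l)}_i(x)=\mu^{(l)}_{i,n}$ for all $l$, $i$ and $0\le n\le 2d$. The point $\mu$ is said to correspond to a global minimum of the original problem if some representing family is such that the sum of product measures $\sum_{l=1}^2\prod_{i=1}^D\mu_i^{(l)}(\cdot)$ is a probability measure carried by the set of global minimizers of $p$ on $\mathcal S$. Theorem. Let $\mu$ be a feasible point of the reformulation with $L=2$, and let $\alpha^{(l)}=\prod_{i=1}^D\mu^{(l)}_{i,0}$. Then $\mu$ corresponds to a global minimum of the original problem if and only if, for each $l\in\{1,2\}$ with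 $\alpha^{(l)}\neq0$, the point $$\left\{\left(\frac{\mu^{(l)}_1}{\alpha^{(l)}},\mu^{(l)}_2,\dots,\mu^{(l)}_D\right),\ (0,\dots,0)\right\}$$ is (feasible and) a local minimum of the reformulation. Equivalently, $\mu$ corresponds to a global minimum of the original problem if and only if $\sum_n p_n\phi_n(\mu)=\min_{x\in\mathcal S}p(x)$, the minimum on the right being attained. In that case, for every family representing $\mu$, the sum of product measures $\sum_{l}\prod_{i}\mu_i^{(l)}(\cdot)$ is a probability measure carried by the set of global minimizers of $p$ on $\mathcal S$. Moreover, for each $l$ with $\alpha^{(l)}\ne0$, if the rescaled point above is a local minimum of the reformulation, then it is a global minimum of the reformulation. -/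

import Mathlib

open MeasureTheory

namespace MomentReformulation

/-! ### The original problem: minimise `p` over the algebraic subset of the hypercube -/

/-- The feasible set `{x ∈ [-1,1]^D : g j x = 0 for all j}` of the original problem. -/
def originalFeasible {D J : ℕ} (g : Fin J → MvPolynomial (Fin D) ℝ) : Set (Fin D → ℝ) :=
  {x | (∀ i, x i ∈ Set.Icc (-1 : ℝ) 1) ∧ ∀ j, MvPolynomial.eval x (g j) = 0}

/-- The set of global minimizers of the original problem. -/
def globalMinimizers {D J : ℕ} (p : MvPolynomial (Fin D) ℝ)
    (g : Fin J → MvPolynomial (Fin D) ℝ) : Set (Fin D → ℝ) :=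
  {x | x ∈ originalFeasible g ∧
    ∀ y ∈ originalFeasible g, MvPolynomial.eval x p ≤ MvPolynomial.eval y p}

/-! ### The reformulated problem -/

/-- The variables of the reformulation, the arrays `μ^{(l)}_{i,n}` with `l < L`, `i < D`,
`0 ≤ n ≤ 2d`. -/
abbrev Moments (L D d : ℕ) : Type := Fin L → Fin D → Fin (2 * d + 1) → ℝ

/-- The entry with index `n` of a vector of `2d+1` moments. Only indices `n ≤ 2d` occur below,
so the value `0` for larger indices plays no role. -/
def entry {d : ℕ} (s : Fin (2 * d + 1) → ℝ) (n : ℕ) : ℝ :=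
  if h : n < 2 * d + 1 then s ⟨n, h⟩ else 0

/-- The `N × N` moment matrix with entries `∑ k, h_k s_{k+m+n}`, `0 ≤ m, n < N`
(that is, the moment matrix of degree `N - 1` associated with `h`). -/
def momentMatrix {d : ℕ} (N : ℕ) (s : Fin (2 * d + 1) → ℝ) (h : Polynomial ℝ) :
    Matrix (Fin N) (Fin N) ℝ :=
  Matrix.of fun m n => ∑ k ∈ h.support, h.coeff k * entry s (k + m + n)

/-- The moments `∏ i, s_{i, n_i}` of one product. -/
def prodMoment {D d : ℕ} (s : Fin D → Fin (2 * d + 1) → ℝ) (n : Fin D →₀ ℕ) : ℝ :=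
  ∏ i, entry (s i) (n i)

/-- The moments `φ_n(μ) = ∑ l, ∏ i, μ^{(l)}_{i, n_i}` of a sum of products. -/
def phi {L D d : ℕ} (μ : Moments L D d) (n : Fin D →₀ ℕ) : ℝ :=
  ∑ l, prodMoment (μ l) n

/-- The objective `∑_{n ∈ supp p} p_n φ_n(μ)`. -/
def objective {L D d : ℕ} (p : MvPolynomial (Fin D) ℝ) (μ : Moments L D d) : ℝ :=
  ∑ n ∈ p.support, p.coeff n * phi μ n

/-- The feasible set of the reformulation. -/
def feasibleSet (L : ℕ) {D J : ℕ} (d : ℕ) (g : Fin J → MvPolynomial (Fin D) ℝ) :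
    Set (Moments L D d) :=
  {μ | (∀ l i, (momentMatrix (d + 1) (μ l i) 1).PosSemidef) ∧
    (∀ l i, (momentMatrix d (μ l i) (1 - Polynomial.X ^ 2)).PosSemidef) ∧
    (∀ j l, ∑ n ∈ (g j ^ 2).support, (g j ^ 2).coeff n * prodMoment (μ l) n = 0) ∧
    phi μ 0 = 1}

/-- `μ` is a local minimum of the reformulation. -/
def IsLocalMinimum {L D J d : ℕ} (p : MvPolynomial (Fin D) ℝ)
    (g : Fin J → MvPolynomial (Fin D) ℝ) (μ : Moments L D d) : Prop :=
  μ ∈ feasibleSet L d g ∧ IsLocalMinOn (objective p) (feasibleSet L d g) μ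

/-- `μ` is a global minimum of the reformulation. -/
def IsGlobalMinimum {L D J d : ℕ} (p : MvPolynomial (Fin D) ℝ)
    (g : Fin J → MvPolynomial (Fin D) ℝ) (μ : Moments L D d) : Prop :=
  μ ∈ feasibleSet L d g ∧ IsMinOn (objective p) (feasibleSet L d g) μ

/-- `α^{(l)} = ∏ i, μ^{(l)}_{i,0}`. -/
def mass {L D d : ℕ} (μ : Moments L D d) (l : Fin L) : ℝ :=
  ∏ i, μ l i 0

/-- The point `{(μ_1^{(l)} / α^{(l)}, μ_2^{(l)}, …, μ_D^{(l)}), (0, …, 0)}`. -/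
noncomputable def rescaledPoint {D d : ℕ} [NeZero D] (μ : Moments 2 D d) (l : Fin 2) :
    Moments 2 D d :=
  ![Function.update (μ l) 0 ((mass μ l)⁻¹ • μ l 0), 0]

/-! ### The correspondence between the two problems -/

/-- The finite Borel measures `m l i` on `ℝ` are supported on `[-1,1]` and have the entries of `μ`
as their moments up to degree `2d`. -/
structure Represents {L D d : ℕ} (m : Fin L → Fin D → Measure ℝ) (μ : Moments L D d) :
    Prop where
  finite : ∀ l i, IsFiniteMeasure (m l i)
  supported : ∀ l i, m l i (Set.Icc (-1 : ℝ) 1)ᶜ = 0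
  moments : ∀ l i (n : Fin (2 * d + 1)), ∫ x, x ^ (n : ℕ) ∂(m l i) = μ l i n

/-- The sum over `l` of the product measures `∏ i, m l i`. -/
noncomputable def sumOfProducts {L D : ℕ} (m : Fin L → Fin D → Measure ℝ) :
    Measure (Fin D → ℝ) :=
  ∑ l, Measure.pi (m l)

/-- `μ` corresponds to a global minimum of the original problem: it is the moment array of a sum of
product measures which is a probability measure carried by the set of global minimizers. -/
def CorrespondsToGlobalMin {L D J d : ℕ} (p : MvPolynomial (Fin D) ℝ)
    (g : Fin J → MvPolynomial (Fin D) ℝ) (μ : Moments L D d) : Prop :=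
  ∃ m : Fin L → Fin D → Measure ℝ, Represents m μ ∧
    IsProbabilityMeasure (sumOfProducts m) ∧ sumOfProducts m (globalMinimizers p g)ᶜ = 0

end MomentReformulation

open MomentReformulation

/-! Integration turns the reformulation into averaging. Each block of a feasible `μ` has a
representing measure on `[-1,1]` (`IsMomentSeq.exists_measure`): a separating functional would be a
polynomial positive on `[-1,1]`, hence of Lukács form, on which the two matrix conditions force a
nonnegative value. The sum of the products is a probability measure. It is carried by the original
feasible set, because each nonnegative `g j ^ 2` integrates to zero
(`Represents.ae_mem_originalFeasible`). Thus the objective is an average of `p` over that set: it is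
at least the minimum (`eval_le_objective`), with equality exactly when the measure sits on the
minimizers (`correspondsToGlobalMin_iff_objective_eq`).

The empty second slot excludes spurious local minima: a small amount of mass can be moved
continuously from the first product to a point mass at a global minimizer, and the objective is
affine in that amount (`IsLocalMinimum.objective_eq`). Finally, the objective at `μ` is the mean,
with weights `mass μ l`, of its values at the rescaled points, so it is minimal exactly when every
value of nonzero weight is. -/

namespace MomentReformulation

/-! ### Lukács representations of polynomials positive on `[-1,1]` -/

open Polynomial in
/-- `q = a² + (1 - x²) b²` with both summands of degree at most `2 e`. -/
def IsLukacs (e : ℕ) (q : ℝ[X]) : Prop :=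
  ∃ a b : ℝ[X], a.natDegree ≤ e ∧ b.natDegree + 1 ≤ e ∧ q = a ^ 2 + (1 - X ^ 2) * b ^ 2

open Polynomial in
lemma natDegree_one_sub_X_sq_le : (1 - X ^ 2 : ℝ[X]).natDegree ≤ 2 := by
  compute_degree

open Polynomial in
-- Brahmagupta's identity for the form `a² + w b²` with `w = 1 - x²`. The cross term `w b d` still
-- fits the degree bound because `b` and `d` each lose one degree.
lemma IsLukacs.mul {e f : ℕ} {q r : ℝ[X]} (hq : IsLukacs e q) (hr : IsLukacs f r) :
    IsLukacs (e + f) (q * r) := by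
  obtain ⟨a, b, ha, hb, rfl⟩ := hq
  obtain ⟨c, d, hc, hd, rfl⟩ := hr
  refine ⟨a * c + (1 - X ^ 2) * (b * d), a * d - b * c, ?_, ?_, by ring⟩
  · refine (natDegree_add_le _ _).trans (max_le (natDegree_mul_le.trans (by omega)) ?_)
    have h1 : (b * d).natDegree ≤ _ := natDegree_mul_le
    have h2 : ((1 - X ^ 2) * (b * d)).natDegree ≤ _ := natDegree_mul_le
    have h3 := natDegree_one_sub_X_sq_le
    omega
  · have h := natDegree_sub_le (a * d) (b * c)
    have h1 : (b * c).natDegree ≤ _ := natDegree_mul_le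
    have h2 : (a * d).natDegree ≤ _ := natDegree_mul_le
    rcases le_total (a * d).natDegree (b * c).natDegree with h' | h'
    · rw [max_eq_right h'] at h; omega
    · rw [max_eq_left h'] at h; omega

open Polynomial in
/-- A polynomial of degree at most two that is positive on `[-1,1]` has a Lukács representation. -/
lemma isLukacs_of_natDegree_le_two {q : ℝ[X]} (hdeg : q.natDegree ≤ 2)
    (hq : ∀ x ∈ Set.Icc (-1 : ℝ) 1, 0 < q.eval x) : IsLukacs 1 q := by
  obtain ⟨A, B, C', rfl⟩ : ∃ A B C' : ℝ, q = C A * X ^ 2 + C B * X + C C' :=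
    ⟨_, _, _, eq_quadratic_of_degree_le_two (natDegree_le_iff_degree_le.1 hdeg)⟩
  have h1 := hq 1 (by norm_num)
  have h2 := hq (-1) (by norm_num)
  simp only [eval_add, eval_mul, eval_C, eval_pow, eval_X] at h1 h2
  -- Here `4u² = q(-1)` and `4v² = q(1)`, so `(u(1-x) - v(1+x))²` agrees with `q` at both endpoints
  -- and the difference is a constant times `1 - x²`.
  set u := √((A - B + C') / 4) with hu
  set v := √((A + B + C') / 4) with hv
  have hu2 : u ^ 2 = (A - B + C') / 4 := Real.sq_sqrt (by linarith)
  have hv2 : v ^ 2 = (A + B + C') / 4 := Real.sq_sqrt (by linarith)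
  have hu0 : 0 < u := Real.sqrt_pos.2 (by linarith)
  have hv0 : 0 < v := Real.sqrt_pos.2 (by linarith)
  -- The square vanishes at `(u-v)/(u+v)`, an interior point, so positivity of `q` there gives the
  -- sign of the constant.
  have ht : 0 ≤ C' - (u - v) ^ 2 := by
    have hx := hq ((u - v) / (u + v)) ⟨by rw [le_div_iff₀ (by positivity)]; linarith,
      by rw [div_le_iff₀ (by positivity)]; linarith⟩
    simp only [eval_add, eval_mul, eval_C, eval_pow, eval_X] at hx
    have hA : A = 2 * (u ^ 2 + v ^ 2) - C' := by linarith
    have hB : B = 2 * (v ^ 2 - u ^ 2) := by linarith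
    have key : A * ((u - v) / (u + v)) ^ 2 + B * ((u - v) / (u + v)) + C' =
        (C' - (u - v) ^ 2) * (4 * u * v / (u + v) ^ 2) := by
      rw [hA, hB]; field_simp; ring
    rw [key] at hx
    exact (pos_of_mul_pos_left hx (by positivity)).le
  refine ⟨C u * (1 - X) - C v * (1 + X), C (√(C' - (u - v) ^ 2)), ?_, by simp, ?_⟩
  · compute_degree
  · rw [← C_pow, Real.sq_sqrt ht]
    apply Polynomial.funext
    intro x
    simp only [eval_add, eval_sub, eval_mul, eval_C, eval_pow, eval_X, eval_one]
    have hA : A = 2 * (u ^ 2 + v ^ 2) - C' := by linarith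
    have hB : B = 2 * (v ^ 2 - u ^ 2) := by linarith
    rw [hA, hB]; ring

open Polynomial in
-- Real irreducible polynomials have degree at most two; two linear factors are merged so that each
-- factor removed has even degree, as the degree bound in Lukács' theorem requires.
lemma exists_natDegree_two_dvd {q : ℝ[X]} (hq : 2 ≤ q.natDegree) :
    ∃ f : ℝ[X], f.natDegree = 2 ∧ f ∣ q := by
  have irr : ∀ r : ℝ[X], 1 ≤ r.natDegree →
      ∃ f : ℝ[X], (f.natDegree = 1 ∨ f.natDegree = 2) ∧ f ∣ r := by
    intro r hr
    obtain ⟨f, hf, hfr⟩ := exists_irreducible_of_natDegree_pos hr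
    have := hf.natDegree_le_two
    have := hf.natDegree_pos
    exact ⟨f, by omega, hfr⟩
  obtain ⟨f, hf | hf, r, rfl⟩ := irr q (by omega)
  · have hne : f * r ≠ 0 := by rintro h; simp [h] at hq
    have hmul := natDegree_mul (left_ne_zero_of_mul hne) (right_ne_zero_of_mul hne)
    obtain ⟨f', hf' | hf', s, rfl⟩ := irr r (by omega)
    · refine ⟨f * f', ?_, s, by ring⟩
      rw [natDegree_mul (left_ne_zero_of_mul hne)
        (left_ne_zero_of_mul (right_ne_zero_of_mul hne)), hf, hf']
    · exact ⟨f', hf', f * s, by ring⟩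
  · exact ⟨f, hf, r, rfl⟩

open Polynomial in
/-- A polynomial without zeros on `[-1,1]` has constant sign there. -/
lemma pos_or_neg_of_eval_ne_zero {f : ℝ[X]} (hf : ∀ x ∈ Set.Icc (-1 : ℝ) 1, f.eval x ≠ 0) :
    (∀ x ∈ Set.Icc (-1 : ℝ) 1, 0 < f.eval x) ∨ ∀ x ∈ Set.Icc (-1 : ℝ) 1, f.eval x < 0 := by
  by_contra! h
  obtain ⟨⟨x, hx, hx0⟩, y, hy, hy0⟩ := h
  obtain ⟨z, hz, hz0⟩ := isPreconnected_Icc.intermediate_value hx hy f.continuous.continuousOn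
    ⟨hx0, hy0⟩
  exact hf z hz hz0

open Polynomial in
/-- **Lukács' theorem** for polynomials that are strictly positive on `[-1,1]`. -/
theorem isLukacs_of_pos {e : ℕ} {q : ℝ[X]} (hdeg : q.natDegree ≤ 2 * (e + 1))
    (hq : ∀ x ∈ Set.Icc (-1 : ℝ) 1, 0 < q.eval x) : IsLukacs (e + 1) q := by
  induction e generalizing q with
  | zero => exact isLukacs_of_natDegree_le_two hdeg hq
  | succ e ih =>
    by_cases h2 : q.natDegree ≤ 2
    · obtain ⟨a, b, ha, hb, h⟩ := isLukacs_of_natDegree_le_two h2 hq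
      exact ⟨a, b, by omega, by omega, h⟩
    obtain ⟨f, hf, r, rfl⟩ := exists_natDegree_two_dvd (q := q) (by omega)
    have hne : f * r ≠ 0 := by rintro h; simp [h] at h2
    have hmul := natDegree_mul (left_ne_zero_of_mul hne) (right_ne_zero_of_mul hne)
    have main : ∀ f r : ℝ[X], f.natDegree = 2 → r.natDegree ≤ 2 * (e + 1) →
        (∀ x ∈ Set.Icc (-1 : ℝ) 1, 0 < (f * r).eval x) →
        (∀ x ∈ Set.Icc (-1 : ℝ) 1, 0 < f.eval x) → IsLukacs (e + 1 + 1) (f * r) := by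
      intro f r hf hr hfr hfpos
      rw [mul_comm]
      refine (ih hr fun x hx => ?_).mul (isLukacs_of_natDegree_le_two hf.le hfpos)
      have := hfr x hx
      rw [eval_mul] at this
      exact pos_of_mul_pos_right this (hfpos x hx).le
    -- A zero of `f` in `[-1,1]` would be a zero of the product, so `f` has constant sign there; if
    -- negative, both factors change sign.
    rcases pos_or_neg_of_eval_ne_zero (f := f) (fun x hx h0 => by
      have := hq x hx; rw [eval_mul, h0, zero_mul] at this; exact this.false) with hs | hs
    · exact main f r hf (by omega) hq hs
    · rw [← neg_mul_neg]
      refine main (-f) (-r) (by simpa using hf) (by rw [natDegree_neg]; omega)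
        (by simpa using hq) (by simpa using hs)


/-! ### The Riesz functional and the moment conditions -/

open Polynomial in
/-- The linear functional `X ^ n ↦ s_n` on univariate polynomials. -/
noncomputable def riesz {d : ℕ} (s : Fin (2 * d + 1) → ℝ) : ℝ[X] →ₗ[ℝ] ℝ :=
  Polynomial.lsum fun n => entry s n • LinearMap.id

open Polynomial in
lemma riesz_apply {d : ℕ} (s : Fin (2 * d + 1) → ℝ) (q : ℝ[X]) :
    riesz s q = ∑ k ∈ q.support, q.coeff k * entry s k := by
  simp [riesz, Polynomial.lsum_apply, Polynomial.sum_def, mul_comm]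

open Polynomial in
lemma riesz_monomial {d : ℕ} (s : Fin (2 * d + 1) → ℝ) (n : ℕ) (c : ℝ) :
    riesz s (monomial n c) = c * entry s n := by
  simp [riesz, Polynomial.lsum_apply, mul_comm]

open Polynomial in
lemma riesz_mul_X_pow {d : ℕ} (s : Fin (2 * d + 1) → ℝ) (h : ℝ[X]) (n : ℕ) :
    riesz s (h * X ^ n) = ∑ k ∈ h.support, h.coeff k * entry s (k + n) := by
  conv_lhs => rw [h.as_sum_support, Finset.sum_mul, map_sum]
  refine Finset.sum_congr rfl fun k _ => ?_
  rw [monomial_mul_X_pow, riesz_monomial]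

open Polynomial in
lemma momentMatrix_apply {d N : ℕ} (s : Fin (2 * d + 1) → ℝ) (h : ℝ[X]) (m n : Fin N) :
    momentMatrix N s h m n = riesz s (h * X ^ (m + n : ℕ)) := by
  simp [momentMatrix, riesz_mul_X_pow, add_assoc]

open Polynomial in
-- The quadratic form of the matrix at a coefficient vector is the functional at `h a²`. The
-- alternative `a = 0` matters only for `N = 0`.
lemma momentMatrix_posSemidef_iff {d N : ℕ} (s : Fin (2 * d + 1) → ℝ) (h : ℝ[X]) :
    (momentMatrix N s h).PosSemidef ↔
      ∀ a : ℝ[X], a.natDegree < N ∨ a = 0 → 0 ≤ riesz s (h * a ^ 2) := by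
  have key : ∀ v : Fin N → ℝ, star v ⬝ᵥ ((momentMatrix N s h).mulVec v) =
      riesz s (h * (∑ i, C (v i) * X ^ (i : ℕ)) ^ 2) := by
    intro v
    rw [sq, Finset.sum_mul_sum, Finset.mul_sum, map_sum]
    refine Finset.sum_congr rfl fun i _ => ?_
    simp only [Matrix.mulVec, dotProduct]
    rw [Finset.mul_sum, Finset.mul_sum, map_sum]
    refine Finset.sum_congr rfl fun j _ => ?_
    rw [momentMatrix_apply, show h * (C (v i) * X ^ (i : ℕ) * (C (v j) * X ^ (j : ℕ))) =
      (v i * v j) • (h * X ^ (i + j : ℕ)) by rw [smul_eq_C_mul, C_mul]; ring, map_smul]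
    simp only [Pi.star_apply, star_trivial, smul_eq_mul]
    ring
  rw [Matrix.posSemidef_iff_dotProduct_mulVec]
  constructor
  · rintro ⟨-, hM⟩ a ha
    rcases ha with ha | rfl
    · have := hM fun i => a.coeff i
      rwa [key, Fin.sum_univ_eq_sum_range (fun i => C (a.coeff i) * X ^ i),
        ← a.as_sum_range_C_mul_X_pow' ha] at this
    · simp
  · intro hL
    refine ⟨?_, fun v => ?_⟩
    · ext i j
      simp [momentMatrix_apply, add_comm]
    · rw [key]
      rcases Nat.eq_zero_or_pos N with rfl | hN
      · simp
      · refine hL _ (Or.inl ?_)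
        refine lt_of_le_of_lt (natDegree_sum_le_of_forall_le (n := N - 1) _ _ fun i _ => ?_)
          (by omega)
        exact (natDegree_C_mul_X_pow_le _ _).trans (by omega)

open Polynomial in
/-- The moment conditions in the definition of the feasible set, for one sequence. -/
def IsMomentSeq {d : ℕ} (s : Fin (2 * d + 1) → ℝ) : Prop :=
  (momentMatrix (d + 1) s 1).PosSemidef ∧ (momentMatrix d s (1 - X ^ 2)).PosSemidef

open Polynomial in
lemma IsMomentSeq.riesz_nonneg {d : ℕ} {s : Fin (2 * d + 1) → ℝ} (hs : IsMomentSeq s) {q : ℝ[X]}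
    (hdeg : q.natDegree ≤ 2 * d) (hq : ∀ x ∈ Set.Icc (-1 : ℝ) 1, 0 < q.eval x) :
    0 ≤ riesz s q := by
  obtain ⟨h1, h2⟩ := hs
  rw [momentMatrix_posSemidef_iff] at h1 h2
  -- For `d = 0` the localizing matrix is empty; `q` is then a positive constant, hence a square.
  rcases d with _ | d
  · rw [eq_C_of_natDegree_eq_zero (Nat.le_zero.1 hdeg)] at hq ⊢
    have hc : 0 < q.coeff 0 := by simpa using hq 0 (by norm_num)
    have := h1 (C (√(q.coeff 0))) (by simp)
    rwa [one_mul, ← C_pow, Real.sq_sqrt hc.le] at this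
  · obtain ⟨a, b, ha, hb, rfl⟩ := isLukacs_of_pos hdeg hq
    rw [map_add]
    refine add_nonneg ?_ (h2 b (Or.inl (by omega)))
    simpa using h1 a (Or.inl (by omega))

lemma entry_fin {d : ℕ} (s : Fin (2 * d + 1) → ℝ) (n : Fin (2 * d + 1)) : entry s n = s n := by
  rw [entry, dif_pos n.2]

open Polynomial in
-- The polynomials `2 ± x^n` are positive on `[-1,1]`; the constant 2 rather than 1 makes them
-- strictly so. The bound forces a sequence of mass zero to vanish.
lemma IsMomentSeq.abs_apply_le {d : ℕ} {s : Fin (2 * d + 1) → ℝ} (hs : IsMomentSeq s)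
    (n : Fin (2 * d + 1)) : |s n| ≤ 2 * s 0 := by
  have key : ∀ c : ℝ, |c| = 1 → 0 ≤ 2 * s 0 + c * s n := by
    intro c hc
    have h := hs.riesz_nonneg (q := C 2 + C c * X ^ (n : ℕ)) ?_ ?_
    · rw [map_add, C_mul_X_pow_eq_monomial, ← monomial_zero_left, riesz_monomial, riesz_monomial,
        entry_fin] at h
      simpa [entry] using h
    · refine (natDegree_add_le _ _).trans (max_le (by simp) ?_)
      exact (natDegree_C_mul_X_pow_le _ _).trans (by omega)
    · intro x hx
      have : |c * x ^ (n : ℕ)| ≤ 1 := by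
        rw [abs_mul, hc, one_mul, abs_pow]
        exact pow_le_one₀ (abs_nonneg _) (abs_le.2 hx)
      have := (abs_le.1 this).1
      simp only [eval_add, eval_mul, eval_C, eval_pow, eval_X]
      linarith
  have h1 := key 1 (by simp)
  have h2 := key (-1) (by simp)
  exact abs_le.2 ⟨by linarith, by linarith⟩

lemma IsMomentSeq.zero_nonneg {d : ℕ} {s : Fin (2 * d + 1) → ℝ} (hs : IsMomentSeq s) :
    0 ≤ s 0 := by
  have := (abs_nonneg _).trans (hs.abs_apply_le 0)
  linarith

lemma IsMomentSeq.eq_zero {d : ℕ} {s : Fin (2 * d + 1) → ℝ} (hs : IsMomentSeq s)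
    (h0 : s 0 = 0) : s = 0 := by
  funext n
  have := hs.abs_apply_le n
  rw [h0, mul_zero] at this
  exact abs_nonpos_iff.1 this

lemma riesz_smul {d : ℕ} (c : ℝ) (s : Fin (2 * d + 1) → ℝ) : riesz (c • s) = c • riesz s := by
  ext n
  simp [riesz_monomial, entry]

lemma IsMomentSeq.smul {d : ℕ} {s : Fin (2 * d + 1) → ℝ} (hs : IsMomentSeq s) {c : ℝ}
    (hc : 0 ≤ c) : IsMomentSeq (c • s) := by
  unfold IsMomentSeq at *
  simp only [momentMatrix_posSemidef_iff, riesz_smul] at *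
  exact ⟨fun a ha => mul_nonneg hc (hs.1 a ha), fun a ha => mul_nonneg hc (hs.2 a ha)⟩

lemma isMomentSeq_zero {d : ℕ} : IsMomentSeq (0 : Fin (2 * d + 1) → ℝ) := by
  unfold IsMomentSeq
  simp only [momentMatrix_posSemidef_iff]
  have : riesz (0 : Fin (2 * d + 1) → ℝ) = 0 := by simpa using riesz_smul 0 (0 : Fin (2 * d + 1) → ℝ)
  simp [this]

open Polynomial in
lemma riesz_pow {d : ℕ} (x : ℝ) {q : ℝ[X]} (hq : q.natDegree ≤ 2 * d) :
    riesz (fun n : Fin (2 * d + 1) => x ^ (n : ℕ)) q = q.eval x := by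
  rw [riesz_apply, eval_eq_sum, sum_def]
  refine Finset.sum_congr rfl fun k hk => ?_
  have : k < 2 * d + 1 := by have := le_natDegree_of_mem_supp k hk; omega
  simp [entry, this]

open Polynomial in
lemma isMomentSeq_pow {d : ℕ} {x : ℝ} (hx : x ∈ Set.Icc (-1 : ℝ) 1) :
    IsMomentSeq (fun n : Fin (2 * d + 1) => x ^ (n : ℕ)) := by
  unfold IsMomentSeq
  simp only [momentMatrix_posSemidef_iff]
  constructor <;> rintro a (ha | rfl)
  · rw [riesz_pow]
    · simp [sq_nonneg]
    · rw [one_mul]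
      exact natDegree_pow_le.trans (by omega)
  · simp
  · rw [riesz_pow]
    · have : 0 ≤ 1 - x ^ 2 := by nlinarith [hx.1, hx.2]
      simpa using mul_nonneg this (sq_nonneg _)
    · have h1 : ((1 - X ^ 2) * a ^ 2 : ℝ[X]).natDegree ≤ _ := natDegree_mul_le
      have h2 := natDegree_one_sub_X_sq_le
      have h3 : (a ^ 2).natDegree ≤ _ := natDegree_pow_le
      omega
  · simp

/-! ### The truncated Hausdorff moment problem -/

/-- The moments up to degree `2d` of a probability measure on `[-1,1]`. -/
noncomputable def moments (d : ℕ) (P : ProbabilityMeasure (Set.Icc (-1 : ℝ) 1)) :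
    Fin (2 * d + 1) → ℝ :=
  fun n => ∫ x, (x : ℝ) ^ (n : ℕ) ∂(P : Measure (Set.Icc (-1 : ℝ) 1))

lemma integrable_of_continuous_Icc {f : Set.Icc (-1 : ℝ) 1 → ℝ} (hf : Continuous f)
    (P : Measure (Set.Icc (-1 : ℝ) 1)) [IsFiniteMeasure P] : Integrable f P :=
  hf.integrable_of_hasCompactSupport (HasCompactSupport.of_compactSpace f)

lemma continuous_moments (d : ℕ) : Continuous (moments d) := by
  refine continuous_pi fun n => ?_
  exact ProbabilityMeasure.continuous_integral_boundedContinuousFunction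
    (BoundedContinuousFunction.mkOfCompact
      ⟨fun x : Set.Icc (-1 : ℝ) 1 => (x : ℝ) ^ (n : ℕ), by fun_prop⟩)

lemma convex_range_moments (d : ℕ) : Convex ℝ (Set.range (moments d)) := by
  rintro _ ⟨P, rfl⟩ _ ⟨Q, rfl⟩ a b ha hb hab
  have hprob : IsProbabilityMeasure (ENNReal.ofReal a • (P : Measure (Set.Icc (-1 : ℝ) 1)) +
      ENNReal.ofReal b • (Q : Measure (Set.Icc (-1 : ℝ) 1))) := by
    constructor
    simp [← ENNReal.ofReal_add ha hb, hab]
  refine ⟨⟨_, hprob⟩, ?_⟩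
  funext n
  simp only [moments, ProbabilityMeasure.coe_mk, Pi.add_apply, Pi.smul_apply, smul_eq_mul]
  have hc : Continuous fun x : Set.Icc (-1 : ℝ) 1 => (x : ℝ) ^ (n : ℕ) := by fun_prop
  rw [integral_add_measure, integral_smul_measure, integral_smul_measure,
    ENNReal.toReal_ofReal ha, ENNReal.toReal_ofReal hb]
  · rfl
  · exact (integrable_of_continuous_Icc hc _).smul_measure (by simp)
  · exact (integrable_of_continuous_Icc hc _).smul_measure (by simp)

open Polynomial in
-- Hahn–Banach: the moment vectors form a compact convex set, and a functional separating `s` from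
-- it is a polynomial. Dirac measures show that it is positive on `[-1,1]`, while its Riesz value at
-- `s` is negative.
lemma IsMomentSeq.mem_range_moments {d : ℕ} {s : Fin (2 * d + 1) → ℝ} (hs : IsMomentSeq s)
    (h1 : s 0 = 1) : s ∈ Set.range (moments d) := by
  by_contra hmem
  obtain ⟨f, u, hf, hu⟩ := geometric_hahn_banach_closed_point (convex_range_moments d)
    (isCompact_range (continuous_moments d)).isClosed hmem
  have hfsum : ∀ v : Fin (2 * d + 1) → ℝ, f v = ∑ n, f (Pi.single n 1) * v n := by
    intro v
    conv_lhs => rw [pi_eq_sum_univ' v]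
    simp [map_sum, mul_comm]
  set q : ℝ[X] := C u - ∑ n : Fin (2 * d + 1), C (f (Pi.single n 1)) * X ^ (n : ℕ) with hq
  have hdeg : q.natDegree ≤ 2 * d := by
    refine (natDegree_sub_le _ _).trans (max_le (by simp) ?_)
    refine natDegree_sum_le_of_forall_le _ _ fun n _ => ?_
    exact (natDegree_C_mul_X_pow_le _ _).trans (by omega)
  have hpos : ∀ x ∈ Set.Icc (-1 : ℝ) 1, 0 < q.eval x := by
    intro x hx
    have := hf _ ⟨⟨Measure.dirac ⟨x, hx⟩, inferInstance⟩, rfl⟩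
    rw [hfsum] at this
    simp only [moments, ProbabilityMeasure.coe_mk, integral_dirac] at this
    simp only [hq, eval_sub, eval_C, eval_finsetSum, eval_mul, eval_pow, eval_X]
    linarith
  have := hs.riesz_nonneg hdeg hpos
  rw [hq, map_sub, map_sum, ← monomial_zero_left, riesz_monomial] at this
  simp only [C_mul_X_pow_eq_monomial, riesz_monomial, entry_fin] at this
  rw [← hfsum] at this
  simp [entry, h1] at this
  linarith

/-- **Truncated Hausdorff moment problem**: a sequence with positive semidefinite moment and
localizing matrices is the moment sequence of a finite measure on `[-1,1]`. -/
theorem IsMomentSeq.exists_measure {d : ℕ} {s : Fin (2 * d + 1) → ℝ} (hs : IsMomentSeq s) :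
    ∃ m : Measure ℝ, IsFiniteMeasure m ∧ m (Set.Icc (-1 : ℝ) 1)ᶜ = 0 ∧
      ∀ n : Fin (2 * d + 1), ∫ x, x ^ (n : ℕ) ∂m = s n := by
  rcases hs.zero_nonneg.eq_or_lt with h0 | h0
  · exact ⟨0, inferInstance, by simp, fun n => by simp [hs.eq_zero h0.symm]⟩
  obtain ⟨P, hP⟩ := (hs.smul (inv_nonneg.2 h0.le)).mem_range_moments
    (by simp [h0.ne'])
  have hemb : MeasurableEmbedding (Subtype.val : Set.Icc (-1 : ℝ) 1 → ℝ) :=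
    MeasurableEmbedding.subtype_coe measurableSet_Icc
  refine ⟨ENNReal.ofReal (s 0) • (P : Measure (Set.Icc (-1 : ℝ) 1)).map Subtype.val, ?_, ?_, fun n => ?_⟩
  · exact Measure.smul_finite _ (by simp)
  · rw [Measure.smul_apply, hemb.map_apply]
    simp
  · have := congrFun hP n
    simp only [moments, Pi.smul_apply, smul_eq_mul] at this
    rw [integral_smul_measure, hemb.integral_map, this, ENNReal.toReal_ofReal h0.le, smul_eq_mul,
      mul_inv_cancel_left₀ h0.ne']


/-! ### The value of a polynomial on a product of moment sequences -/

/-- The value `∑ n, P_n ∏ i, s_{i, n_i}` of a polynomial on a product of moment sequences. -/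
noncomputable def prodValue {D d : ℕ} (P : MvPolynomial (Fin D) ℝ)
    (s : Fin D → Fin (2 * d + 1) → ℝ) : ℝ :=
  ∑ n ∈ P.support, P.coeff n * prodMoment s n

lemma objective_eq_sum {L D d : ℕ} (p : MvPolynomial (Fin D) ℝ) (μ : Moments L D d) :
    objective p μ = ∑ l, prodValue p (μ l) := by
  simp only [objective, phi, prodValue, Finset.mul_sum]
  exact Finset.sum_comm

lemma mem_feasibleSet_iff {L D J d : ℕ} {g : Fin J → MvPolynomial (Fin D) ℝ}
    {μ : Moments L D d} : μ ∈ feasibleSet L d g ↔ (∀ l i, IsMomentSeq (μ l i)) ∧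
      (∀ j l, prodValue (g j ^ 2) (μ l) = 0) ∧ phi μ 0 = 1 := by
  simp only [feasibleSet, Set.mem_ofPred_eq, IsMomentSeq, prodValue]
  exact ⟨fun ⟨h1, h2, h3⟩ => ⟨fun l i => ⟨h1 l i, h2 l i⟩, h3⟩,
    fun ⟨h1, h3⟩ => ⟨fun l i => (h1 l i).1, fun l i => (h1 l i).2, h3⟩⟩

lemma mass_eq_prodMoment {L D d : ℕ} (μ : Moments L D d) (l : Fin L) :
    mass μ l = prodMoment (μ l) 0 := by
  simp [mass, prodMoment, entry]

lemma prodMoment_update {D d : ℕ} (s : Fin D → Fin (2 * d + 1) → ℝ) (i : Fin D) (c : ℝ)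
    (n : Fin D →₀ ℕ) : prodMoment (Function.update s i (c • s i)) n = c * prodMoment s n := by
  simp only [prodMoment]
  rw [← Finset.mul_prod_erase _ _ (Finset.mem_univ i), ← Finset.mul_prod_erase _ (fun j =>
    entry (s j) (n j)) (Finset.mem_univ i), ← mul_assoc]
  congr 1
  · simp [entry]
  · refine Finset.prod_congr rfl fun j hj => ?_
    rw [Function.update_of_ne (Finset.ne_of_mem_erase hj)]

lemma prodMoment_smul {D d : ℕ} (s : Fin D → Fin (2 * d + 1) → ℝ) (c : ℝ)
    (n : Fin D →₀ ℕ) : prodMoment (c • s) n = c ^ D * prodMoment s n := by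
  have : ∀ i, entry ((c • s) i) (n i) = c * entry (s i) (n i) := fun i => by simp [entry]
  simp only [prodMoment, this, Finset.prod_mul_distrib]
  simp

lemma prodMoment_eq_zero {D d : ℕ} {s : Fin D → Fin (2 * d + 1) → ℝ}
    (hs : ∀ i, IsMomentSeq (s i)) (h0 : prodMoment s 0 = 0) (n : Fin D →₀ ℕ) :
    prodMoment s n = 0 := by
  obtain ⟨i, -, hi⟩ := Finset.prod_eq_zero_iff.1 h0
  refine Finset.prod_eq_zero (Finset.mem_univ i) ?_
  rw [(hs i).eq_zero (by simpa [entry] using hi)]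
  simp [entry]

lemma prodMoment_zero {D d : ℕ} [NeZero D] (n : Fin D →₀ ℕ) :
    prodMoment (0 : Fin D → Fin (2 * d + 1) → ℝ) n = 0 :=
  Finset.prod_eq_zero (Finset.mem_univ 0) (by simp [entry])

lemma prodValue_zero {D d : ℕ} [NeZero D] (P : MvPolynomial (Fin D) ℝ) :
    prodValue P (0 : Fin D → Fin (2 * d + 1) → ℝ) = 0 := by
  simp [prodValue, prodMoment_zero]

lemma prodValue_update {D d : ℕ} (P : MvPolynomial (Fin D) ℝ)
    (s : Fin D → Fin (2 * d + 1) → ℝ) (i : Fin D) (c : ℝ) :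
    prodValue P (Function.update s i (c • s i)) = c * prodValue P s := by
  simp only [prodValue, prodMoment_update, Finset.mul_sum]
  exact Finset.sum_congr rfl fun n _ => by ring

lemma prodValue_smul {D d : ℕ} (P : MvPolynomial (Fin D) ℝ)
    (s : Fin D → Fin (2 * d + 1) → ℝ) (c : ℝ) :
    prodValue P (c • s) = c ^ D * prodValue P s := by
  simp only [prodValue, prodMoment_smul, Finset.mul_sum]
  exact Finset.sum_congr rfl fun n _ => by ring

/-- Ensures that the default value of `entry` never intervenes. -/
lemma apply_lt_of_mem_support {D d : ℕ} {P : MvPolynomial (Fin D) ℝ} (hP : P.totalDegree ≤ 2 * d)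
    {n : Fin D →₀ ℕ} (hn : n ∈ P.support) (i : Fin D) : n i < 2 * d + 1 := by
  have h1 := MvPolynomial.le_totalDegree hn
  have h2 : n i ≤ n.degree := Finsupp.le_degree i n
  rw [Finsupp.degree_apply] at h2
  simp only [Finsupp.sum] at h1
  omega

/-- The moments of the point mass at `x`. -/
def pointMoments {D : ℕ} (d : ℕ) (x : Fin D → ℝ) : Fin D → Fin (2 * d + 1) → ℝ :=
  fun i n => x i ^ (n : ℕ)

lemma prodValue_pointMoments {D d : ℕ} {P : MvPolynomial (Fin D) ℝ} (hP : P.totalDegree ≤ 2 * d)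
    (x : Fin D → ℝ) : prodValue P (pointMoments d x) = MvPolynomial.eval x P := by
  rw [MvPolynomial.eval_eq', prodValue]
  refine Finset.sum_congr rfl fun n hn => ?_
  congr 1
  refine Finset.prod_congr rfl fun i _ => ?_
  rw [entry, dif_pos (apply_lt_of_mem_support hP hn i)]
  rfl

lemma prodMoment_pointMoments_zero {D d : ℕ} (x : Fin D → ℝ) :
    prodMoment (pointMoments d x) 0 = 1 := by
  simp [prodMoment, entry, pointMoments]

/-! ### Integration against product measures -/

lemma integrable_pow_of_supported {m : Measure ℝ} [IsFiniteMeasure m]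
    (hm : m (Set.Icc (-1 : ℝ) 1)ᶜ = 0) (n : ℕ) : Integrable (fun x : ℝ => x ^ n) m := by
  refine Integrable.of_bound (by fun_prop) 1 ?_
  have : ∀ᵐ x ∂m, x ∈ Set.Icc (-1 : ℝ) 1 := hm
  filter_upwards [this] with x hx
  rw [norm_pow, Real.norm_eq_abs]
  exact pow_le_one₀ (abs_nonneg _) (abs_le.2 hx)

lemma Represents.integral_eval {L D d : ℕ} {m : Fin L → Fin D → Measure ℝ} {μ : Moments L D d}
    (h : Represents m μ) (l : Fin L) {P : MvPolynomial (Fin D) ℝ} (hP : P.totalDegree ≤ 2 * d) :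
    Integrable (fun x => MvPolynomial.eval x P) (Measure.pi (m l)) ∧
      ∫ x, MvPolynomial.eval x P ∂(Measure.pi (m l)) = prodValue P (μ l) := by
  have := h.finite
  have hint : ∀ n : Fin D →₀ ℕ, Integrable (fun x : Fin D → ℝ => P.coeff n * ∏ i, x i ^ n i)
      (Measure.pi (m l)) := fun n => (Integrable.fintype_prod (f := fun i (x : ℝ) => x ^ n i)
        fun i => integrable_pow_of_supported (h.supported l i) _).const_mul _
  simp only [MvPolynomial.eval_eq']
  refine ⟨integrable_finsetSum _ fun n _ => hint n, ?_⟩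
  rw [integral_finsetSum _ fun n _ => hint n, prodValue]
  refine Finset.sum_congr rfl fun n hn => ?_
  rw [integral_const_mul, integral_fintype_prod_eq_prod (fun i (x : ℝ) => x ^ n i)]
  congr 1
  refine Finset.prod_congr rfl fun i _ => ?_
  have hi := apply_lt_of_mem_support hP hn i
  rw [entry, dif_pos hi, ← h.moments l i ⟨n i, hi⟩]

lemma Represents.integral_eval_sumOfProducts {L D d : ℕ} {m : Fin L → Fin D → Measure ℝ}
    {μ : Moments L D d} (h : Represents m μ) {P : MvPolynomial (Fin D) ℝ}
    (hP : P.totalDegree ≤ 2 * d) :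
    Integrable (fun x => MvPolynomial.eval x P) (sumOfProducts m) ∧
      ∫ x, MvPolynomial.eval x P ∂(sumOfProducts m) = objective P μ := by
  refine ⟨integrable_finsetSum_measure.2 fun l _ => (h.integral_eval l hP).1, ?_⟩
  rw [sumOfProducts, integral_finsetSum_measure fun l _ => (h.integral_eval l hP).1,
    objective_eq_sum]
  exact Finset.sum_congr rfl fun l _ => (h.integral_eval l hP).2

lemma exists_represents {L D J d : ℕ} {g : Fin J → MvPolynomial (Fin D) ℝ} {μ : Moments L D d}
    (hμ : μ ∈ feasibleSet L d g) : ∃ m : Fin L → Fin D → Measure ℝ, Represents m μ := by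
  choose m h1 h2 h3 using fun l i => ((mem_feasibleSet_iff.1 hμ).1 l i).exists_measure
  exact ⟨m, h1, h2, h3⟩

lemma Represents.isProbabilityMeasure {L D J d : ℕ} {g : Fin J → MvPolynomial (Fin D) ℝ}
    {m : Fin L → Fin D → Measure ℝ} {μ : Moments L D d} (h : Represents m μ)
    (hμ : μ ∈ feasibleSet L d g) : IsProbabilityMeasure (sumOfProducts m) := by
  obtain ⟨hint, hval⟩ := h.integral_eval_sumOfProducts (P := 1) (by simp)
  have hobj : objective 1 μ = 1 := by
    rw [← (mem_feasibleSet_iff.1 hμ).2.2, objective]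
    simp [MvPolynomial.support_one]
  rw [hobj] at hval
  simp only [map_one, integral_const, smul_eq_mul, mul_one] at hval
  exact ⟨by rwa [measureReal_def, ENNReal.toReal_eq_one_iff] at hval⟩

lemma ae_sumOfProducts_iff {L D : ℕ} {m : Fin L → Fin D → Measure ℝ} {q : (Fin D → ℝ) → Prop} :
    (∀ᵐ x ∂(sumOfProducts m), q x) ↔ ∀ l, ∀ᵐ x ∂(Measure.pi (m l)), q x := by
  simp [ae_iff, sumOfProducts, Measure.finsetSum_apply]

/-- The constraint is imposed on squares: a nonnegative function of integral zero vanishes almost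
everywhere. -/
lemma Represents.ae_mem_originalFeasible {L D J d : ℕ} {g : Fin J → MvPolynomial (Fin D) ℝ}
    (hg : ∀ j, (g j).totalDegree ≤ d) {m : Fin L → Fin D → Measure ℝ} {μ : Moments L D d}
    (h : Represents m μ) (hμ : μ ∈ feasibleSet L d g) :
    ∀ᵐ x ∂(sumOfProducts m), x ∈ originalFeasible g := by
  have := h.finite
  rw [ae_sumOfProducts_iff]
  intro l
  refine (Filter.eventually_all.2 fun i => ?_).and (Filter.eventually_all.2 fun j => ?_)
  · have : ∀ᵐ x ∂(m l i), x ∈ Set.Icc (-1 : ℝ) 1 := h.supported l i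
    exact Measure.tendsto_eval_ae_ae.eventually this
  · obtain ⟨hint, hval⟩ := h.integral_eval l (P := g j ^ 2)
      ((MvPolynomial.totalDegree_pow _ _).trans (Nat.mul_le_mul_left 2 (hg j)))
    rw [(mem_feasibleSet_iff.1 hμ).2.1 j l, integral_eq_zero_iff_of_nonneg
      (fun x => by simp [sq_nonneg]) hint] at hval
    filter_upwards [hval] with x hx
    simpa using hx

/-! ### Comparison of the two problems -/

lemma exists_mem_globalMinimizers {L D J d : ℕ} (p : MvPolynomial (Fin D) ℝ)
    {g : Fin J → MvPolynomial (Fin D) ℝ} (hg : ∀ j, (g j).totalDegree ≤ d) {μ : Moments L D d}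
    (hμ : μ ∈ feasibleSet L d g) : ∃ x, x ∈ globalMinimizers p g := by
  obtain ⟨m, hm⟩ := exists_represents hμ
  have := hm.isProbabilityMeasure hμ
  have hne : (originalFeasible g).Nonempty := (hm.ae_mem_originalFeasible hg hμ).exists
  have hcomp : IsCompact (originalFeasible g) := by
    have hset : originalFeasible g = (Set.univ.pi fun _ => Set.Icc (-1 : ℝ) 1) ∩
        ⋂ j, {x | MvPolynomial.eval x (g j) = 0} := by
      ext x; simp only [originalFeasible, Set.mem_ofPred_eq, Set.mem_inter_iff, Set.mem_univ_pi,
        Set.mem_iInter]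
    rw [hset]
    exact (isCompact_univ_pi fun _ => isCompact_Icc).inter_right
      (isClosed_iInter fun j => isClosed_eq (MvPolynomial.continuous_eval _) continuous_const)
  obtain ⟨x, hx, hmin⟩ := hcomp.exists_isMinOn hne
    (MvPolynomial.continuous_eval p).continuousOn
  exact ⟨x, hx, fun y hy => hmin hy⟩

lemma eval_le_objective {L D J d : ℕ} {p : MvPolynomial (Fin D) ℝ}
    {g : Fin J → MvPolynomial (Fin D) ℝ} (hp : p.totalDegree ≤ d)
    (hg : ∀ j, (g j).totalDegree ≤ d) {x : Fin D → ℝ} (hx : x ∈ globalMinimizers p g)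
    {μ : Moments L D d} (hμ : μ ∈ feasibleSet L d g) :
    MvPolynomial.eval x p ≤ objective p μ := by
  obtain ⟨m, hm⟩ := exists_represents hμ
  have := hm.isProbabilityMeasure hμ
  obtain ⟨hint, hval⟩ := hm.integral_eval_sumOfProducts (P := p) (by omega)
  have := integral_mono_ae (integrable_const (MvPolynomial.eval x p)) hint
    ((hm.ae_mem_originalFeasible hg hμ).mono fun y hy => hx.2 y hy)
  simpa [hval] using this

lemma Represents.sumOfProducts_compl_globalMinimizers {L D J d : ℕ} {p : MvPolynomial (Fin D) ℝ}
    {g : Fin J → MvPolynomial (Fin D) ℝ} (hp : p.totalDegree ≤ d)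
    (hg : ∀ j, (g j).totalDegree ≤ d) {x : Fin D → ℝ} (hx : x ∈ globalMinimizers p g)
    {μ : Moments L D d} (hμ : μ ∈ feasibleSet L d g) (hobj : objective p μ = MvPolynomial.eval x p)
    {m : Fin L → Fin D → Measure ℝ} (hm : Represents m μ) :
    sumOfProducts m (globalMinimizers p g)ᶜ = 0 := by
  have := hm.isProbabilityMeasure hμ
  have hS := hm.ae_mem_originalFeasible hg hμ
  obtain ⟨hint, hval⟩ := hm.integral_eval_sumOfProducts (P := p) (by omega)
  have hzero : ∫ y, (MvPolynomial.eval y p - MvPolynomial.eval x p) ∂(sumOfProducts m) = 0 := by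
    rw [integral_sub hint (integrable_const _), hval, hobj]
    simp
  rw [integral_eq_zero_iff_of_nonneg_ae (hS.mono fun y hy => sub_nonneg.2 (hx.2 y hy))
    (hint.sub (integrable_const _))] at hzero
  change ∀ᵐ y ∂(sumOfProducts m), y ∈ globalMinimizers p g
  filter_upwards [hS, hzero] with y hy hy0
  refine ⟨hy, fun z hz => ?_⟩
  rw [sub_eq_zero.1 hy0]
  exact hx.2 z hz

/-- A feasible point corresponds to a global minimum of the original problem if and only if its
objective is the minimum of the original problem. -/
theorem correspondsToGlobalMin_iff_objective_eq {L D J d : ℕ} {p : MvPolynomial (Fin D) ℝ}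
    {g : Fin J → MvPolynomial (Fin D) ℝ} (hp : p.totalDegree ≤ d)
    (hg : ∀ j, (g j).totalDegree ≤ d) {x : Fin D → ℝ} (hx : x ∈ globalMinimizers p g)
    {μ : Moments L D d} (hμ : μ ∈ feasibleSet L d g) :
    CorrespondsToGlobalMin p g μ ↔ objective p μ = MvPolynomial.eval x p := by
  constructor
  · rintro ⟨m, hm, hprob, hnull⟩
    rw [← (hm.integral_eval_sumOfProducts (P := p) (by omega)).2]
    have hae : ∀ᵐ y ∂(sumOfProducts m), y ∈ globalMinimizers p g := hnull
    rw [integral_congr_ae (g := fun _ => MvPolynomial.eval x p)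
      (hae.mono fun y hy => le_antisymm (hy.2 x hx.1) (hx.2 y hy.1))]
    simp
  · intro hobj
    obtain ⟨m, hm⟩ := exists_represents hμ
    exact ⟨m, hm, hm.isProbabilityMeasure hμ,
      hm.sumOfProducts_compl_globalMinimizers hp hg hx hμ hobj⟩

/-! ### Local minima of the rescaled form -/

lemma isMomentSeq_update {D d : ℕ} {s : Fin D → Fin (2 * d + 1) → ℝ}
    (hs : ∀ i, IsMomentSeq (s i)) (i : Fin D) {c : ℝ} (hc : 0 ≤ c) (j : Fin D) :
    IsMomentSeq (Function.update s i (c • s i) j) := by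
  rcases eq_or_ne j i with rfl | hj
  · rw [Function.update_self]; exact (hs j).smul hc
  · rw [Function.update_of_ne hj]; exact hs j

lemma objective_pair {D d : ℕ} (p : MvPolynomial (Fin D) ℝ)
    (s t : Fin D → Fin (2 * d + 1) → ℝ) :
    objective p (![s, t] : Moments 2 D d) = prodValue p s + prodValue p t := by
  simp [objective_eq_sum]

lemma pair_mem_feasibleSet {D J d : ℕ} {g : Fin J → MvPolynomial (Fin D) ℝ}
    {s t : Fin D → Fin (2 * d + 1) → ℝ} :
    (![s, t] : Moments 2 D d) ∈ feasibleSet 2 d g ↔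
      ((∀ i, IsMomentSeq (s i)) ∧ ∀ i, IsMomentSeq (t i)) ∧
        (∀ j, prodValue (g j ^ 2) s = 0 ∧ prodValue (g j ^ 2) t = 0) ∧
          prodMoment s 0 + prodMoment t 0 = 1 := by
  simp [mem_feasibleSet_iff, Fin.forall_fin_two, phi]

/-- At a local minimum whose second summand vanishes, mass can be moved continuously to a global
minimizer of the original problem, so the objective is already minimal. -/
theorem IsLocalMinimum.objective_eq {D J d : ℕ} [NeZero D] {p : MvPolynomial (Fin D) ℝ}
    {g : Fin J → MvPolynomial (Fin D) ℝ} (hp : p.totalDegree ≤ d)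
    (hg : ∀ j, (g j).totalDegree ≤ d) {x : Fin D → ℝ} (hx : x ∈ globalMinimizers p g)
    {s : Fin D → Fin (2 * d + 1) → ℝ} (hs : IsLocalMinimum p g (![s, 0] : Moments 2 D d)) :
    objective p (![s, 0] : Moments 2 D d) = MvPolynomial.eval x p := by
  refine le_antisymm ?_ (eval_le_objective hp hg hx hs.1)
  obtain ⟨hfeas, hloc⟩ := hs
  obtain ⟨⟨hs1, -⟩, hs2, hs3⟩ := pair_mem_feasibleSet.1 hfeas
  rw [prodMoment_zero, add_zero] at hs3
  -- Scaling one factor of `s` multiplies its product by `1 - τ^D`, while scaling all `D` factors of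
  -- the point mass gives weight `τ^D`; the total stays 1. Scaling all factors makes the second
  -- block tend to zero as `τ → 0`.
  let γ : ℝ → Moments 2 D d := fun τ =>
    ![Function.update s 0 ((1 - τ ^ D) • s 0), τ • pointMoments d x]
  have hγ0 : γ 0 = ![s, 0] := by
    simp [γ, NeZero.ne D]
  have hγc : Continuous γ := by
    refine continuous_pi fun l => ?_
    fin_cases l
    · simp only [γ]
      exact continuous_const.update 0 (by fun_prop)
    · simp only [γ]
      change Continuous fun τ : ℝ => τ • pointMoments d x
      fun_prop
  have hγobj : ∀ τ, objective p (γ τ) =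
      (1 - τ ^ D) * prodValue p s + τ ^ D * MvPolynomial.eval x p := fun τ => by
    rw [objective_pair, prodValue_update, prodValue_smul, prodValue_pointMoments (by omega)]
  have hγfeas : ∀ τ ∈ Set.Icc (0 : ℝ) 1, γ τ ∈ feasibleSet 2 d g := by
    intro τ hτ
    refine pair_mem_feasibleSet.2 ⟨⟨isMomentSeq_update hs1 0 ?_, fun i => ?_⟩, fun j => ⟨?_, ?_⟩, ?_⟩
    · exact sub_nonneg.2 (pow_le_one₀ hτ.1 hτ.2)
    · exact (isMomentSeq_pow (hx.1.1 i)).smul hτ.1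
    · rw [prodValue_update, (hs2 j).1, mul_zero]
    · rw [prodValue_smul, prodValue_pointMoments
        ((MvPolynomial.totalDegree_pow _ _).trans (Nat.mul_le_mul_left 2 (hg j)))]
      simp [hx.1.2 j]
    · rw [prodMoment_update, prodMoment_smul, prodMoment_pointMoments_zero, hs3]
      ring
  have htend : Filter.Tendsto γ (nhdsWithin 0 (Set.Ioc 0 1))
      (nhdsWithin ![s, 0] (feasibleSet 2 d g)) := by
    refine tendsto_nhdsWithin_iff.2 ⟨hγ0 ▸ hγc.continuousWithinAt, ?_⟩
    filter_upwards [self_mem_nhdsWithin] with τ hτ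
    exact hγfeas τ ⟨hτ.1.le, hτ.2⟩
  have hne : (nhdsWithin (0 : ℝ) (Set.Ioc 0 1)).NeBot := by
    rw [nhdsWithin_Ioc_eq_nhdsGT one_pos]
    infer_instance
  obtain ⟨τ, hτ, hτ0⟩ := ((htend.eventually hloc).and self_mem_nhdsWithin).exists
  rw [hγobj, objective_pair, prodValue_zero, add_zero] at hτ
  rw [objective_pair, prodValue_zero, add_zero]
  have hpos : 0 < τ ^ D := pow_pos hτ0.1 D
  exact le_of_mul_le_mul_left (by linarith) hpos

lemma mass_nonneg {L D J d : ℕ} {g : Fin J → MvPolynomial (Fin D) ℝ} {μ : Moments L D d}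
    (hμ : μ ∈ feasibleSet L d g) (l : Fin L) : 0 ≤ mass μ l :=
  Finset.prod_nonneg fun i _ => ((mem_feasibleSet_iff.1 hμ).1 l i).zero_nonneg

lemma rescaledPoint_mem_feasibleSet {D J d : ℕ} [NeZero D] {g : Fin J → MvPolynomial (Fin D) ℝ}
    {μ : Moments 2 D d} (hμ : μ ∈ feasibleSet 2 d g) {l : Fin 2} (hl : mass μ l ≠ 0) :
    rescaledPoint μ l ∈ feasibleSet 2 d g := by
  obtain ⟨h1, h2, -⟩ := mem_feasibleSet_iff.1 hμ
  refine pair_mem_feasibleSet.2 ⟨⟨isMomentSeq_update (h1 l) 0 (inv_nonneg.2 (mass_nonneg hμ l)),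
    fun i => isMomentSeq_zero⟩, fun j => ⟨?_, prodValue_zero _⟩, ?_⟩
  · rw [prodValue_update, h2, mul_zero]
  · rw [prodMoment_update, prodMoment_zero, ← mass_eq_prodMoment, add_zero, inv_mul_cancel₀ hl]

lemma mass_mul_objective_rescaledPoint {D J d : ℕ} [NeZero D] (p : MvPolynomial (Fin D) ℝ)
    {g : Fin J → MvPolynomial (Fin D) ℝ} {μ : Moments 2 D d} (hμ : μ ∈ feasibleSet 2 d g)
    (l : Fin 2) : mass μ l * objective p (rescaledPoint μ l) = prodValue p (μ l) := by
  rw [rescaledPoint, objective_pair, prodValue_update, prodValue_zero, add_zero]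
  by_cases hl : mass μ l = 0
  · rw [hl, zero_mul, prodValue, Finset.sum_eq_zero]
    intro n _
    rw [prodMoment_eq_zero ((mem_feasibleSet_iff.1 hμ).1 l) (mass_eq_prodMoment μ l ▸ hl),
      mul_zero]
  · exact mul_inv_cancel_left₀ hl _

end MomentReformulation

/-! ### The main theorem: weighted mean of the rescaled values -/

theorem mainTheorem3 {D J d : ℕ} [NeZero D]
    (p : MvPolynomial (Fin D) ℝ) (g : Fin J → MvPolynomial (Fin D) ℝ)
    (hp : p.totalDegree ≤ d) (hg : ∀ j, (g j).totalDegree ≤ d)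
    (μ : Moments 2 D d) (hμ : μ ∈ feasibleSet 2 d g) :
    -- the characterization
    (CorrespondsToGlobalMin p g μ ↔
      ∀ l : Fin 2, mass μ l ≠ 0 → IsLocalMinimum p g (rescaledPoint μ l)) ∧
    -- equivalently, in terms of values: the objective at `μ` is the minimum of the original problem
    (CorrespondsToGlobalMin p g μ ↔
      IsLeast ((fun x => MvPolynomial.eval x p) '' originalFeasible g) (objective p μ)) ∧
    -- any sum of product measures with these moments then sits on the global minimizers
    (CorrespondsToGlobalMin p g μ →
      ∀ m : Fin 2 → Fin D → Measure ℝ, Represents m μ →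
        IsProbabilityMeasure (sumOfProducts m) ∧
          sumOfProducts m (globalMinimizers p g)ᶜ = 0) ∧
    -- local minima of the rescaled form are never spurious
    (∀ l : Fin 2, mass μ l ≠ 0 → IsLocalMinimum p g (rescaledPoint μ l) →
      IsGlobalMinimum p g (rescaledPoint μ l)) := by
  obtain ⟨x, hx⟩ := exists_mem_globalMinimizers p hg hμ
  have hcorr := correspondsToGlobalMin_iff_objective_eq hp hg hx hμ
  have hleast : IsLeast ((fun x => MvPolynomial.eval x p) '' originalFeasible g)
      (MvPolynomial.eval x p) :=
    ⟨⟨x, hx.1, rfl⟩, by rintro _ ⟨y, hy, rfl⟩; exact hx.2 y hy⟩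
  have hglobal : ∀ l : Fin 2, mass μ l ≠ 0 →
      objective p (rescaledPoint μ l) = MvPolynomial.eval x p →
      IsGlobalMinimum p g (rescaledPoint μ l) := fun l hl hobj =>
    ⟨rescaledPoint_mem_feasibleSet hμ hl, fun ν hν => by
      change objective p (rescaledPoint μ l) ≤ objective p ν
      rw [hobj]
      exact eval_le_objective hp hg hx hν⟩
  have hlocal : ∀ l : Fin 2, IsLocalMinimum p g (rescaledPoint μ l) →
      objective p (rescaledPoint μ l) = MvPolynomial.eval x p := fun l h =>
    h.objective_eq hp hg hx
  have hobj : ∑ l, mass μ l * objective p (rescaledPoint μ l) = objective p μ := by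
    rw [objective_eq_sum]
    exact Finset.sum_congr rfl fun l _ => mass_mul_objective_rescaledPoint p hμ l
  have hmass : ∑ l, mass μ l = 1 := by
    simp only [mass_eq_prodMoment]
    exact (mem_feasibleSet_iff.1 hμ).2.2
  -- The excess over the minimum is a weighted sum of the excesses at the rescaled points; the terms
  -- of nonzero weight are nonnegative, so the total vanishes only if each term does.
  have hdiff : ∑ l, mass μ l * (objective p (rescaledPoint μ l) - MvPolynomial.eval x p) =
      objective p μ - MvPolynomial.eval x p := by
    simp only [mul_sub, Finset.sum_sub_distrib]
    rw [hobj, ← Finset.sum_mul, hmass, one_mul]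
  refine ⟨?_, ?_, fun h m hm => ⟨hm.isProbabilityMeasure hμ,
    hm.sumOfProducts_compl_globalMinimizers hp hg hx hμ (hcorr.1 h)⟩,
    fun l hl h => hglobal l hl (hlocal l h)⟩
  · rw [hcorr]
    constructor
    · intro h l hl
      rw [h, sub_self, Finset.sum_eq_zero_iff_of_nonneg] at hdiff
      · have := (mul_eq_zero.1 (hdiff l (Finset.mem_univ l))).resolve_left hl
        have hgl := hglobal l hl (sub_eq_zero.1 this)
        exact ⟨hgl.1, hgl.2.localize⟩
      · intro k _
        by_cases hk : mass μ k = 0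
        · simp [hk]
        · exact mul_nonneg (mass_nonneg hμ k) (sub_nonneg.2
            (eval_le_objective hp hg hx (rescaledPoint_mem_feasibleSet hμ hk)))
    · intro h
      rw [← sub_eq_zero, ← hdiff]
      refine Finset.sum_eq_zero fun l _ => ?_
      by_cases hl : mass μ l = 0
      · rw [hl, zero_mul]
      · rw [hlocal l (h l hl), sub_self, mul_zero]
  · rw [hcorr]
    exact ⟨fun h => h ▸ hleast, fun h => h.unique hleast⟩
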